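/- Let $n\ge 3$, let $m_1,\dots,m_n>0$ be masses, and let $M=\mathrm{diag}(m_1I_2,\dots,m_nI_2)$ and $K=\mathrm{diag}(J,\dots,J)$, with $J=\begin{pmatrix}0&-1\\1&0\end{pmatrix}$, act on $\mathbb R^{2n}$. Let $\hat X$ be the set of $q=(q_1,\dots,q_n)\in(\mathbb R^2)^n$ with $q_i\ne q_j$ for $i\neq j$ and $\sum_i m_iq_i=0$, and let $I(q)=\langle Mq,q\rangle=\sum_i m_i|q_i|^2$. Let $U$ be one of the potentials $$U_\alpha(q)=\sum_{i<j}\frac{m_im_j}{|q_i-q_j|^{\alpha}}\quad(0<\alpha<2),\qquad U_{\log}(q)=-\sum_{i<j}m_im_j\log|q_i-q_j| .$$ A point $\bar x\in\hat X$ is a central configuration for $U$ if, for some smooth function $r>0$ on some open interval $(a,b)$ with $a<b$, $q(t)=r(t)\bar x$ is a classical solution of Newton's equations $M\ddot q=\nabla U(q)$. Let $\bar x$ be a central configuration for $U$, normalised by $I(\bar x)=1$ (so that $\bar x$ represents a point of the shape sphere $\mathbb S=\{q\in\hat X: I(q)=1\}/\mathrm{SO}(2)$). Put $\omega=\sqrt\lambda$,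 where $\lambda=\alpha U_\alpha(\bar x)/I(\bar x)$ if $U=U_\alpha$ and $\lambda=\sum_{i<j}m_im_j/I(\bar x)$ if $U=U_{\log}$. The corresponding relative equilibrium is $\bar z=(\bar x,-\omega MK\bar x)$; that is, $\bar x$ is a critical point of $x\mapsto U(x)+\tfrac12\omega^2\langle MKx,Kx\rangle$, and $\bar z$ is an equilibrium of the Hamiltonian system in the uniformly rotating frame, $$\dot x=\omega Kx+M^{-1}y,\qquad \dot y=\nabla U(x)+\omega Ky .$$ The linearisation of this system at $\bar z$ is $$L=\begin{pmatrix}\omega K&M^{-1}\\ D^2U(\bar x)&\omega K\end{pmatrix}.$$ Let $v=(1,0,1,0,\dots,1,0)\in\mathbb R^{2n}$, let $E_1$ be the span in $\mathbb R^{2n}\times\mathbb R^{2n}$ of $(v,0),(Kv,0),(0,Mv),(0,KMv)$, let $E_2$ be the span of $(\bar x,0),(K\bar x,0),(0,M\bar x),(0,KM\bar x)$, and let $E_3$ be the complement of $E_1\oplus E_2$ with respect to the symplectic form $\Omega((x,y),(x',y'))=\langle x,y'\rangle-\langle y,x'\rangle$; it is $L$-invariant. The relative equilibrium is called linearly stable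 if all eigenvalues of $L_3=L|_{E_3}$ lie in $i\mathbb R$ and $L_3$ is diagonalisable over $\mathbb C$, and linearly unstable otherwise. The Morse index and the nullity of $\bar x$ are the index (the maximal dimension of a negative definite subspace) and the nullity (the dimension of the radical) of the quadratic form $w\mapsto\langle(D^2U(\bar x)+\omega^2M)w,w\rangle$ on $\{w\in\mathbb R^{2n}:(w,0)\in E_3\}$, which is the tangent space of the shape sphere at $\bar x$; this form is the Hessian of $U|_{\mathbb S}$ at $\bar x$. If the Morse index or the nullity of $\bar x$ is odd, then the corresponding relative equilibrium is linearly unstable. (For $\alpha=1$ this is the gravitational case, due to Hu and Sun.) -/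

import Mathlib

noncomputable section

namespace NBody

/-- The Euclidean plane. -/
abbrev Plane : Type := EuclideanSpace ℝ (Fin 2)

/-- `ℝ^{2n}` with its Euclidean inner product; the coordinate `(i, a)` is the `a`-th coordinate of
the `i`-th particle. -/
abbrev Config (n : ℕ) : Type := EuclideanSpace ℝ (Fin n × Fin 2)

/-- The position `qᵢ` of the `i`-th particle. -/
def particle {n : ℕ} (q : Config n) (i : Fin n) : Plane := !₂[q (i, 0), q (i, 1)]

/-- The phase space `ℝ^{2n} × ℝ^{2n}`, with elements `(x, y)` = (positions, momenta). -/
abbrev Phase (n : ℕ) : Type := Config n × Config n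

/-- `K = diag(J, …, J)`, where `J (a, b) = (-b, a)` is the complex structure of the plane. -/
def rotK (n : ℕ) : Config n →ₗ[ℝ] Config n where
  toFun q := WithLp.toLp 2 (fun p => if p.2 = 0 then -q (p.1, 1) else q (p.1, 0))
  map_add' q r := by
    ext p
    by_cases h : p.2 = 0 <;> simp [h, add_comm]
  map_smul' c q := by
    ext p
    by_cases h : p.2 = 0 <;> simp [h]

/-- `diag(c₁ I₂, …, cₙ I₂)`. -/
def blockDiag {n : ℕ} (c : Fin n → ℝ) : Config n →ₗ[ℝ] Config n where
  toFun q := WithLp.toLp 2 (fun p => c p.1 * q p)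
  map_add' q r := by ext p; simp [mul_add]
  map_smul' c q := by ext p; simp [mul_left_comm]

/-- The mass matrix `M = diag(m₁ I₂, …, mₙ I₂)`. -/
def massM {n : ℕ} (m : Fin n → ℝ) : Config n →ₗ[ℝ] Config n := blockDiag m

/-- The inverse `M⁻¹` of the mass matrix (the masses are positive). -/
def massInv {n : ℕ} (m : Fin n → ℝ) : Config n →ₗ[ℝ] Config n := blockDiag (fun i => (m i)⁻¹)

/-- The moment of inertia `I(q) = ⟨Mq, q⟩ = ∑ mᵢ |qᵢ|²`. -/
def inertia {n : ℕ} (m : Fin n → ℝ) (q : Config n) : ℝ := ∑ i, m i * ‖particle q i‖ ^ 2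

/-- The collision-free configuration space `X`. -/
def collisionFree (n : ℕ) : Set (Config n) := {q | ∀ i j, i ≠ j → particle q i ≠ particle q j}

/-- The reduced configuration space `X̂`: no collision, centre of mass at the origin. -/
def reducedSpace {n : ℕ} (m : Fin n → ℝ) : Set (Config n) :=
  {q | q ∈ collisionFree n ∧ ∑ i, m i • particle q i = 0}

/-- The ellipsoid of inertia `S = {q ∈ X̂ | I(q) = 1}`. -/
def ellipsoid {n : ℕ} (m : Fin n → ℝ) : Set (Config n) :=
  {q | q ∈ reducedSpace m ∧ inertia m q = 1}

/-- The `α`-homogeneous potential `U_α(q) = ∑_{i<j} mᵢ mⱼ / |qᵢ - qⱼ|^α`. -/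
def potHom {n : ℕ} (m : Fin n → ℝ) (α : ℝ) (q : Config n) : ℝ :=
  ∑ i, ∑ j ∈ Finset.Ioi i, m i * m j / ‖particle q i - particle q j‖ ^ α

/-- The logarithmic potential `U_log(q) = -∑_{i<j} mᵢ mⱼ log |qᵢ - qⱼ|`. -/
def potLog {n : ℕ} (m : Fin n → ℝ) (q : Config n) : ℝ :=
  -∑ i, ∑ j ∈ Finset.Ioi i, m i * m j * Real.log ‖particle q i - particle q j‖

/-- The multiplier `λ_α = α U_α(q) / I(q)`. -/
def lamHom {n : ℕ} (m : Fin n → ℝ) (α : ℝ) (q : Config n) : ℝ :=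
  α * potHom m α q / inertia m q

/-- The multiplier `λ_log = (∑_{i<j} mᵢ mⱼ) / I(q)`. -/
def lamLog {n : ℕ} (m : Fin n → ℝ) (q : Config n) : ℝ :=
  (∑ i, ∑ j ∈ Finset.Ioi i, m i * m j) / inertia m q

/-- `q` is a classical solution on the open interval `(a, b)` of Newton's equations
`M q'' = ∇U(q)` on `X`. -/
def IsNewtonSolution {n : ℕ} (m : Fin n → ℝ) (U : Config n → ℝ) (a b : ℝ)
    (q : ℝ → Config n) : Prop :=
  ContDiffOn ℝ 2 q (Set.Ioo a b) ∧
    ∀ t ∈ Set.Ioo a b, q t ∈ collisionFree n ∧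
      massM m (deriv (deriv q) t) = gradient U (q t)

/-- `x ∈ X̂` is a (planar) central configuration for `U`: for some smooth positive `r` on some
interval `(a, b)`, the homothetic motion `t ↦ r(t) x` solves Newton's equations. -/
def IsCentralConfiguration {n : ℕ} (m : Fin n → ℝ) (U : Config n → ℝ) (x : Config n) : Prop :=
  x ∈ reducedSpace m ∧
    ∃ a b : ℝ, a < b ∧ ∃ r : ℝ → ℝ,
      ContDiffOn ℝ ((⊤ : ℕ∞) : WithTop ℕ∞) r (Set.Ioo a b) ∧
      (∀ t ∈ Set.Ioo a b, 0 < r t) ∧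
      IsNewtonSolution m U a b (fun t => r t • x)

/-- The augmented potential `U_Ξ(x) = U(x) + ½ ‖Ξ x‖²_M`, with `Ξ = ω K`. -/
def augmentedPotential {n : ℕ} (m : Fin n → ℝ) (U : Config n → ℝ) (ω : ℝ) (x : Config n) : ℝ :=
  U x + 1 / 2 * inertia m (ω • rotK n x)

/-- `(x, y)` is a relative equilibrium with angular velocity `ω`: `y = -M Ξ x`, with `Ξ = ω K`, and
`x ∈ X` is a critical point of the augmented potential. -/
def IsRelativeEquilibrium {n : ℕ} (m : Fin n → ℝ) (U : Config n → ℝ) (ω : ℝ)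
    (z : Phase n) : Prop :=
  z.1 ∈ collisionFree n ∧ z.2 = -massM m (ω • rotK n z.1) ∧
    HasGradientAt (augmentedPotential m U ω) 0 z.1

/-- The point `(x, -M Ξ x)`, with `Ξ = ω K`, of the phase space. -/
def relEq {n : ℕ} (m : Fin n → ℝ) (ω : ℝ) (x : Config n) : Phase n :=
  (x, -massM m (ω • rotK n x))

/-- The Hamiltonian vector field in the uniformly rotating frame:
`x' = ω K x + M⁻¹ y`, `y' = ∇U(x) + ω K y`. -/
def rotatingField {n : ℕ} (m : Fin n → ℝ) (U : Config n → ℝ) (ω : ℝ) (z : Phase n) : Phase n :=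
  (ω • rotK n z.1 + massInv m z.2, gradient U z.1 + ω • rotK n z.2)

/-- The linearisation `L` at `z` of the system in the rotating frame: in block form, for
`z = (x, y)`, its rows are `(ωK, M⁻¹)` and `(D²U(x), ωK)`. -/
def linearization {n : ℕ} (m : Fin n → ℝ) (U : Config n → ℝ) (ω : ℝ) (z : Phase n) :
    Phase n →ₗ[ℝ] Phase n :=
  (fderiv ℝ (rotatingField m U ω) z).toLinearMap

/-- The standard symplectic form `Ω(z, w) = ⟨J z, w⟩`, with `J (x, y) = (-y, x)`. -/
def symplecticForm (n : ℕ) : LinearMap.BilinForm ℝ (Phase n) :=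
  LinearMap.mk₂ ℝ (fun z w => inner ℝ (-z.2) w.1 + inner ℝ z.1 w.2)
    (by intro a b c; simp [inner_add_left]; ring)
    (by intro c a b; simp [inner_smul_left]; ring)
    (by intro a b c; simp [inner_add_right]; ring)
    (by intro c a b; simp [inner_smul_right]; ring)

/-- For a configuration `u`, the span of `(u, 0)`, `(K u, 0)`, `(0, M u)`, `(0, K M u)`. -/
def fourSpan {n : ℕ} (m : Fin n → ℝ) (u : Config n) : Submodule ℝ (Phase n) :=
  Submodule.span ℝ {(u, 0), (rotK n u, 0), (0, massM m u), (0, rotK n (massM m u))}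

/-- The vector `(1, 0, 1, 0, …, 1, 0)`. -/
def translationVec (n : ℕ) : Config n := WithLp.toLp 2 (fun p => if p.2 = 0 then 1 else 0)

/-- `E₁`, spanned by the translations: position and momentum of the centre of mass. -/
def spaceE1 {n : ℕ} (m : Fin n → ℝ) : Submodule ℝ (Phase n) := fourSpan m (translationVec n)

/-- `E₂`, generated by the dilations and the rotations of `x`. -/
def spaceE2 {n : ℕ} (m : Fin n → ℝ) (x : Config n) : Submodule ℝ (Phase n) := fourSpan m x

/-- `E₃`, the symplectic complement of `E₁ ⊕ E₂`. -/
def spaceE3 {n : ℕ} (m : Fin n → ℝ) (x : Config n) : Submodule ℝ (Phase n) :=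
  (symplecticForm n).orthogonal (spaceE1 m ⊔ spaceE2 m x)

/-- A real endomorphism is spectrally stable if all its complex eigenvalues lie in `iℝ`. -/
def IsSpectrallyStable {V : Type} [AddCommGroup V] [Module ℝ V] (f : V →ₗ[ℝ] V) : Prop :=
  ∀ μ : ℂ, Module.End.HasEigenvalue (f.baseChange ℂ) μ → μ.re = 0

/-- A real endomorphism is linearly stable if it is spectrally stable and diagonalisable over `ℂ`,
that is, the eigenspaces of its complexification span. -/
def IsLinearlyStable {V : Type} [AddCommGroup V] [Module ℝ V] (f : V →ₗ[ℝ] V) : Prop :=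
  IsSpectrallyStable f ∧ ⨆ μ : ℂ, Module.End.eigenspace (f.baseChange ℂ) μ = ⊤

/-- A relative equilibrium `z = (x, y)` is linearly unstable if `E₃` is invariant under the
linearisation `L` at `z`, and the restriction `L₃` of `L` to `E₃` is not linearly stable.
(Invariance is asserted here so that `L₃` makes sense.) -/
def IsLinearlyUnstable {n : ℕ} (m : Fin n → ℝ) (U : Config n → ℝ) (ω : ℝ) (z : Phase n) : Prop :=
  ∃ h : ∀ w ∈ spaceE3 m z.1, linearization m U ω z w ∈ spaceE3 m z.1,
    ¬ IsLinearlyStable ((linearization m U ω z).restrict h)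

/-- The Hessian `D²U(x)`, as an operator. -/
def hessian {n : ℕ} (U : Config n → ℝ) (x : Config n) : Config n →ₗ[ℝ] Config n :=
  (fderiv ℝ (gradient U) x).toLinearMap

/-- The configuration part `{v | (v, 0) ∈ E₃}` of `E₃`: the `M`-orthogonal complement of the
translations, of `x` and of `K x`, which is the tangent space at `x` of the shape sphere. -/
def configE3 {n : ℕ} (m : Fin n → ℝ) (x : Config n) : Submodule ℝ (Config n) :=
  (spaceE3 m x).comap (LinearMap.inl ℝ (Config n) (Config n))

/-- The Hessian at the central configuration `x` of the potential on the shape sphere: the quadratic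
form `v ↦ ⟨(D²U(x) + ω² M) v, v⟩` on the configuration part of `E₃`. -/
def shapeHessian {n : ℕ} (m : Fin n → ℝ) (U : Config n → ℝ) (ω : ℝ) (x : Config n) :
    QuadraticForm ℝ (configE3 m x) :=
  QuadraticMap.restrict
    (LinearMap.BilinMap.toQuadraticMap
      ((innerₗ (Config n)).comp (hessian U x + ω ^ 2 • massM m)))
    (configE3 m x)

/-- The Morse index of the central configuration `x`. -/
def morseIndex {n : ℕ} (m : Fin n → ℝ) (U : Config n → ℝ) (ω : ℝ) (x : Config n) : ℕ :=
  sigNeg (shapeHessian m U ω x)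

/-- The nullity of the central configuration `x`. -/
def nullity {n : ℕ} (m : Fin n → ℝ) (U : Config n → ℝ) (ω : ℝ) (x : Config n) : ℕ :=
  Module.finrank ℝ (shapeHessian m U ω x).radical

end NBody

end

/-! Let W be the configuration part of E₃. In a basis of W that is orthonormal for M and
diagonalises H = D²U(x) + ω²M, with diagonal entries d forming D, the matrix of K is skew, and
invertible because K² = -1; so dim W is even. Eliminating the momentum turns L₃z = μz into the
quadratic pencil (μ² - 2μωK - D)c = 0. Suppose L₃ is linearly stable. Then the pencil is invertible
for every real μ ≠ 0, and its determinant is positive for μ > 0, by deformation to μ = ∞.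

As μ → 0 the pencil tends to -D, which may be singular. Pulling one factor μ out of each row indexed
by ker D leaves a limit with determinant det N · ∏(-d), the product running over the nonzero d,
where N is the compression of -2ωK to ker D. A kernel vector of N would start a Jordan block of L₃
at 0, so N is invertible; being skew, it has even size and positive determinant. Hence the nullity
is even, the number of positive d is even, and so is what remains of dim W, the Morse index. The
matrix part is `even_card_of_pencil`, the reduction to it `isLinearlyUnstable_of_odd`.

That L preserves E₃ follows by differentiating the symmetry identities of U at x
(`inner_axes_hessian`). Both potentials obey one scaling law, U(ρq) = ρ^(-β) U(q) + c log ρ, and are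
treated together. -/

section

open Matrix
open scoped TensorProduct

/-! ### Skew matrices and the sign of the determinant of the pencil -/

/-- A continuous family of real matrices that starts at the identity and stays invertible keeps a
positive determinant. -/
theorem det_pos_of_continuous_of_ne_zero {ι : Type*} [Fintype ι] [DecidableEq ι]
    {f : ℝ → Matrix ι ι ℝ} (hf : Continuous f) (h0 : f 0 = 1)
    (hne : ∀ t, 0 < t → (f t).det ≠ 0) {t : ℝ} (ht : 0 < t) : 0 < (f t).det := by
  by_contra hneg
  have hc : ContinuousOn (fun s => (f s).det) (Set.Icc 0 t) := hf.matrix_det.continuousOn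
  have hmem : (0 : ℝ) ∈ Set.Icc (f t).det (f 0).det := by
    simp [h0, not_lt.1 hneg]
  obtain ⟨s, hs, hs0⟩ := intermediate_value_Icc' ht.le hc hmem
  rcases hs.1.eq_or_lt with h | h
  · subst h
    simp [h0] at hs0
  · exact hne s h hs0

theorem dotProduct_mulVec_self_of_skew {ι : Type*} [Fintype ι] {A : Matrix ι ι ℝ}
    (hA : Aᵀ = -A) (c : ι → ℝ) : c ⬝ᵥ (A *ᵥ c) = 0 := by
  have h : c ⬝ᵥ (A *ᵥ c) = -(c ⬝ᵥ (A *ᵥ c)) := by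
    conv_lhs => rw [dotProduct_mulVec, ← mulVec_transpose, hA, neg_mulVec, neg_dotProduct,
      dotProduct_comm]
  linarith

/-- A real skew-symmetric matrix has a nonnegative determinant. -/
theorem det_nonneg_of_skew {ι : Type*} [Fintype ι] [DecidableEq ι] {A : Matrix ι ι ℝ}
    (hA : Aᵀ = -A) : 0 ≤ A.det := by
  have hpos : ∀ t : ℝ, 0 < t → 0 < (1 + t • A).det := by
    intro t ht
    refine det_pos_of_continuous_of_ne_zero (f := fun t => 1 + t • A) (by fun_prop) (by simp) ?_ ht
    intro s _ h
    obtain ⟨c, hc, hc0⟩ := exists_mulVec_eq_zero_iff.2 h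
    have h1 : c ⬝ᵥ ((1 + s • A) *ᵥ c) = 0 := by rw [hc0, dotProduct_zero]
    rw [add_mulVec, one_mulVec, smul_mulVec, dotProduct_add, dotProduct_smul,
      dotProduct_mulVec_self_of_skew hA, smul_zero, add_zero] at h1
    exact hc (dotProduct_self_eq_zero.1 h1)
  -- A itself may be singular, so det A is reached as the limit of det(t + A), where t + A = t(1 +
  -- t⁻¹A) has positive determinant for t > 0.
  have hlim : Filter.Tendsto (fun t : ℝ => (t • (1 : Matrix ι ι ℝ) + A).det)
      (nhdsWithin 0 (Set.Ioi 0)) (nhds A.det) := by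
    have : Continuous fun t : ℝ => (t • (1 : Matrix ι ι ℝ) + A).det := by
      apply Continuous.matrix_det; fun_prop
    have h := (this.tendsto 0).mono_left (nhdsWithin_le_nhds (s := Set.Ioi 0))
    simpa using h
  refine ge_of_tendsto hlim (Filter.eventually_of_mem self_mem_nhdsWithin fun t ht => ?_)
  have ht : 0 < t := ht
  have : t • (1 : Matrix ι ι ℝ) + A = t • (1 + t⁻¹ • A) := by
    rw [smul_add, smul_smul, mul_inv_cancel₀ ht.ne', one_smul]
  rw [this, det_smul]
  exact (mul_pos (pow_pos ht _) (hpos _ (inv_pos.2 ht))).le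

/-- An invertible skew-symmetric matrix has even size. -/
theorem even_card_of_skew {ι : Type*} [Fintype ι] [DecidableEq ι] {A : Matrix ι ι ℝ}
    (hA : Aᵀ = -A) (h : A.det ≠ 0) : Even (Fintype.card ι) := by
  by_contra hodd
  have h1 := A.det_transpose
  rw [hA, det_neg, (Nat.not_even_iff_odd.1 hodd).neg_one_pow] at h1
  exact h (by linarith)

open scoped Classical in
/-- If the pencil `μ² - 2μωK - D`, with `K` skew and `D = diag d`, is invertible for all real
`μ ≠ 0`, and the compression of `K` to the kernel of `D` is invertible, then that kernel is
even-dimensional and the number of positive entries of `D` is even. -/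
theorem even_card_of_pencil {ι : Type*} [Fintype ι] {K : Matrix ι ι ℝ} (hK : Kᵀ = -K)
    (d : ι → ℝ) {ω : ℝ} (hω : 0 < ω)
    (hker : ∀ c : ι → ℝ, (∀ i, d i ≠ 0 → c i = 0) → (∀ i, d i = 0 → (K *ᵥ c) i = 0) → c = 0)
    (hpencil : ∀ μ : ℝ, μ ≠ 0 → ∀ c : ι → ℝ,
      (∀ i, μ ^ 2 * c i - 2 * μ * ω * (K *ᵥ c) i - d i * c i = 0) → c = 0) :
    Even (Fintype.card {i // d i = 0}) ∧ Even (Fintype.card {i // 0 < d i}) := by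
  -- `P` is the pencil; `Q` is its reversal in t = 1/μ, which equals 1 at t = 0; `T` is `P` with a
  -- factor μ removed from each row where d vanishes, so that `T 0` keeps first-order information on
  -- the kernel of D.
  set P : ℝ → Matrix ι ι ℝ := fun μ => μ ^ 2 • 1 - (2 * μ * ω) • K - diagonal d with hP
  set Q : ℝ → Matrix ι ι ℝ := fun t => 1 - (2 * t * ω) • K - t ^ 2 • diagonal d with hQ
  set T : ℝ → Matrix ι ι ℝ := fun μ => of fun i j =>
    if d i = 0 then μ * (1 : Matrix ι ι ℝ) i j - 2 * ω * K i j else P μ i j with hT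
  have hPne : ∀ μ, μ ≠ 0 → (P μ).det ≠ 0 := by
    intro μ hμ h
    obtain ⟨c, hc, hc0⟩ := exists_mulVec_eq_zero_iff.2 h
    refine hc (hpencil μ hμ c fun i => ?_)
    have := congrFun hc0 i
    simpa [hP, sub_mulVec, smul_mulVec, mulVec_diagonal] using this
  have hPQ : ∀ μ, 0 < μ → P μ = μ ^ 2 • Q μ⁻¹ := by
    intro μ hμ
    simp only [hP, hQ, smul_sub, smul_smul]
    congr 2
    · congr 1; field_simp
    · rw [← mul_pow, mul_inv_cancel₀ hμ.ne', one_pow, one_smul]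
  have hQne : ∀ t, 0 < t → (Q t).det ≠ 0 := by
    intro t ht h
    have h1 := hPQ t⁻¹ (inv_pos.2 ht)
    rw [inv_inv] at h1
    apply hPne t⁻¹ (inv_ne_zero ht.ne')
    rw [h1, det_smul, h, mul_zero]
  have hPpos : ∀ μ, 0 < μ → 0 < (P μ).det := by
    intro μ hμ
    rw [hPQ μ hμ, det_smul]
    exact mul_pos (by positivity) (det_pos_of_continuous_of_ne_zero (f := Q) (by fun_prop)
      (by simp [hQ]) hQne (inv_pos.2 hμ))
  have hPT : ∀ μ, P μ = diagonal (fun i => if d i = 0 then μ else 1) * T μ := by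
    intro μ
    ext i j
    rw [diagonal_mul]
    by_cases h : d i = 0
    · by_cases hij : i = j
      · subst hij; simp [hP, hT, h]; ring
      · simp [hP, hT, h, hij]; ring
    · simp [hT, h]
  have hTpos : ∀ μ, 0 < μ → 0 < (T μ).det := by
    intro μ hμ
    have h := hPpos μ hμ
    rw [hPT, det_mul, det_diagonal] at h
    refine pos_of_mul_pos_right h (Finset.prod_nonneg fun i _ => ?_)
    split_ifs <;> simp [hμ.le]
  -- Only the weak inequality survives the limit μ → 0⁺; strictness comes later from the factors of
  -- `(T 0).det`.
  have hT0 : 0 ≤ (T 0).det := by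
    have hcont : Continuous fun μ => (T μ).det := by
      apply Continuous.matrix_det
      refine continuous_matrix fun i j => ?_
      by_cases h : d i = 0
      · simp only [hT, of_apply, h, if_true]; fun_prop
      · simp only [hT, of_apply, h, if_false, hP, Matrix.sub_apply, Matrix.smul_apply]; fun_prop
    exact ge_of_tendsto ((hcont.tendsto 0).mono_left (nhdsWithin_le_nhds (s := Set.Ioi 0)))
      (Filter.eventually_of_mem self_mem_nhdsWithin fun t ht => (hTpos t ht).le)
  set N : Matrix {i // d i = 0} {i // d i = 0} ℝ := toSquareBlockProp (T 0) fun i => d i = 0 with hN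
  have hNK : N = of fun i j : {i // d i = 0} => -(2 * ω) * K i j := by
    ext i j
    simp [hN, hT, toSquareBlockProp, i.2]
  have hNskew : Nᵀ = -N := by
    ext i j
    have := congrFun (congrFun hK i) j
    simp only [transpose_apply, Matrix.neg_apply] at this
    simp [hNK, this]
  have hNdet : N.det ≠ 0 := by
    intro h
    obtain ⟨c, hc, hc0⟩ := exists_mulVec_eq_zero_iff.2 h
    refine hc ?_
    -- Extended by zero, a kernel vector of `N` is a vector of ker D whose image under K has no
    -- component in ker D.
    have h1 := hker (fun i => if h : d i = 0 then c ⟨i, h⟩ else 0) (by intro i hi; simp [hi]) ?_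
    · funext i
      have := congrFun h1 i
      simpa [i.2] using this
    · intro i hi
      have h2 := congrFun hc0 ⟨i, hi⟩
      rw [hNK] at h2
      simp only [mulVec, dotProduct, of_apply, Pi.zero_apply, mul_assoc, ← Finset.mul_sum] at h2
      have h3 := (mul_eq_zero.1 h2).resolve_left (by linarith)
      rw [mulVec, dotProduct]
      refine Eq.trans ?_ h3
      rw [← Fintype.sum_subtype_add_sum_subtype (fun i => d i = 0)]
      rw [Finset.sum_eq_zero (s := (Finset.univ : Finset {i // ¬ d i = 0}))
        (fun j _ => by simp [j.2]), add_zero]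
      exact Finset.sum_congr rfl fun j _ => by simp [j.2]
  -- At μ = 0 the rows outside the kernel reduce to those of -D, so `T 0` is block triangular.
  have hdet : (T 0).det = N.det * ∏ i : {i // ¬ d i = 0}, -d i := by
    rw [twoBlockTriangular_det (T 0) fun i => d i = 0]
    · congr 1
      rw [← det_diagonal]
      congr 1
      ext i j
      by_cases hij : i = j
      · subst hij
        simp [hT, hP, toSquareBlockProp, i.2]
      · have : (i : ι) ≠ j := fun h => hij (Subtype.ext h)
        simp [hT, hP, toSquareBlockProp, i.2, hij, this]
    · intro i hi j hj
      have : i ≠ j := by rintro rfl; exact hi hj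
      simp [hT, hP, hi, this]
  refine ⟨even_card_of_skew hNskew hNdet, ?_⟩
  have hprod : 0 ≤ ∏ i : {i // ¬ d i = 0}, -d i := by
    rw [hdet] at hT0
    exact nonneg_of_mul_nonneg_right hT0 ((det_nonneg_of_skew hNskew).lt_of_ne' hNdet)
  -- The factor -d is negative exactly when d > 0, so the sign of the product is the parity of the
  -- number of positive entries.
  have hsplit : ∏ i : {i // ¬ d i = 0}, -d i
      = (∏ i : {i // ¬ d i = 0}, |d i|) * ∏ i : ι, if 0 < d i then (-1 : ℝ) else 1 := by
    rw [← Fintype.prod_subtype_mul_prod_subtype (fun i => d i = 0),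
      Finset.prod_eq_one (s := (Finset.univ : Finset {i // d i = 0})) (fun j _ => by simp [j.2]),
      one_mul, ← Finset.prod_mul_distrib]
    refine Finset.prod_congr rfl fun i _ => ?_
    split_ifs with h
    · rw [abs_of_pos h]; ring
    · rw [abs_of_nonpos (not_lt.1 h)]; ring
  rw [hsplit] at hprod
  have habs : 0 < ∏ i : {i // ¬ d i = 0}, |d i| :=
    Finset.prod_pos fun i _ => abs_pos.2 i.2
  have hsign := nonneg_of_mul_nonneg_right hprod habs
  rw [Finset.prod_ite, Finset.prod_const, Finset.prod_const_one, mul_one,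
    ← Fintype.card_subtype] at hsign
  by_contra hodd
  rw [(Nat.not_even_iff_odd.1 hodd).neg_one_pow] at hsign
  linarith

/-! ### Consequences of linear stability; simultaneous diagonalisation -/

/-- A linearly stable real endomorphism has no nonzero real eigenvalue. -/
theorem NBody.IsLinearlyStable.eq_zero_of_eigenvector {V : Type} [AddCommGroup V] [Module ℝ V]
    {f : V →ₗ[ℝ] V} (hf : NBody.IsLinearlyStable f) {μ : ℝ} (hμ : μ ≠ 0) {z : V}
    (hz : f z = μ • z) : z = 0 := by
  by_contra hne
  have h1 : (1 : ℂ) ⊗ₜ[ℝ] z ≠ 0 := fun h =>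
    hne (Module.FaithfullyFlat.tensorProduct_mk_injective (A := ℝ) (B := ℂ) V (by simpa using h))
  have h2 : f.baseChange ℂ ((1 : ℂ) ⊗ₜ[ℝ] z) = (μ : ℂ) • ((1 : ℂ) ⊗ₜ[ℝ] z) := by
    rw [LinearMap.baseChange_tmul, hz, TensorProduct.tmul_smul, TensorProduct.smul_tmul',
      TensorProduct.smul_tmul', Complex.real_smul, smul_eq_mul]
  have h3 := hf.1 (μ : ℂ) (Module.End.hasEigenvalue_of_hasEigenvector
    ⟨Module.End.mem_eigenspace_iff.2 h2, h1⟩)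
  exact hμ (by simpa using h3)

/-- If the eigenspaces of an endomorphism span, its zero eigenvalue is semisimple. -/
theorem Module.End.apply_eq_zero_of_iSup_eigenspace_eq_top {k V : Type*} [Field k]
    [AddCommGroup V] [Module k V] {f : Module.End k V} (hf : ⨆ μ, f.eigenspace μ = ⊤) {z : V}
    (hz : f (f z) = 0) : f z = 0 := by
  -- On a sum of eigenspaces the image avoids the zero eigenspace: it lies in the sum of the others,
  -- which is independent of ker f.
  have hrange : ∀ y, f y ∈ ⨆ (μ : k) (_ : μ ≠ 0), f.eigenspace μ := by
    intro y
    have hy : y ∈ ⨆ μ, f.eigenspace μ := hf ▸ Submodule.mem_top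
    induction hy using Submodule.iSup_induction' with
    | mem μ y hy =>
      rw [Module.End.mem_eigenspace_iff.1 hy]
      by_cases h : μ = 0
      · simp [h]
      · exact Submodule.smul_mem _ _ (Submodule.mem_iSup_of_mem μ (Submodule.mem_iSup_of_mem h hy))
    | zero => simp
    | add y₁ y₂ _ _ h₁ h₂ => rw [map_add]; exact add_mem h₁ h₂
  exact Submodule.disjoint_def.1 (f.eigenspaces_iSupIndep 0) _
    (Module.End.mem_eigenspace_iff.2 (by rw [hz, zero_smul])) (hrange z)

/-- The zero eigenvalue of a linearly stable real endomorphism is semisimple. -/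
theorem NBody.IsLinearlyStable.apply_eq_zero_of_apply_apply_eq_zero {V : Type} [AddCommGroup V]
    [Module ℝ V] {f : V →ₗ[ℝ] V} (hf : NBody.IsLinearlyStable f) {z : V}
    (hz : f (f z) = 0) : f z = 0 := by
  have h := Module.End.apply_eq_zero_of_iSup_eigenspace_eq_top hf.2 (z := (1 : ℂ) ⊗ₜ[ℝ] z)
    (by simp [LinearMap.baseChange_tmul, hz])
  exact Module.FaithfullyFlat.tensorProduct_mk_injective (A := ℝ) (B := ℂ) V (by simpa using h)

/-- Simultaneous diagonalisation of a positive definite and of a symmetric bilinear form. -/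
theorem exists_basis_simultaneous_diagonal {V : Type*} [AddCommGroup V] [Module ℝ V]
    [FiniteDimensional ℝ V] (g h : V →ₗ[ℝ] V →ₗ[ℝ] ℝ) (hg : ∀ v w, g v w = g w v)
    (hpos : ∀ v, v ≠ 0 → 0 < g v v) (hh : ∀ v w, h v w = h w v) :
    ∃ (k : ℕ) (b : Module.Basis (Fin k) ℝ V) (d : Fin k → ℝ),
      (∀ i j, g (b i) (b j) = if i = j then 1 else 0) ∧
      ∀ i j, h (b i) (b j) = if i = j then d i else 0 := by
  -- Taking `g` as the inner product makes `h` a self-adjoint operator `T`, and the spectral theorem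
  -- applies.
  let c : InnerProductSpace.Core ℝ V :=
    { inner := fun v w => g v w
      conj_inner_symm := fun v w => by simp [hg v w]
      re_inner_nonneg := fun v => by
        by_cases hv : v = 0
        · simp [hv]
        · simpa using (hpos v hv).le
      add_left := fun u v w => by simp
      smul_left := fun u v r => by simp
      definite := fun v hv => by
        by_contra hne
        exact (hpos v hne).ne' hv }
  let : NormedAddCommGroup V := c.toNormedAddCommGroup
  let : InnerProductSpace ℝ V := InnerProductSpace.ofCore c.toCore
  have hin : ∀ v w : V, inner ℝ v w = g v w := fun v w => rfl
  let T : V →ₗ[ℝ] V :=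
    { toFun := fun v => (InnerProductSpace.toDual ℝ V).symm (LinearMap.toContinuousLinearMap (h v))
      map_add' := fun v w => by simp
      map_smul' := fun r v => by simp }
  have hT : ∀ v w, inner ℝ (T v) w = h v w := fun v w => by simp [T]
  have hsymm : T.IsSymmetric := fun v w => by rw [hT, real_inner_comm, hT, hh]
  let b := hsymm.eigenvectorBasis rfl
  refine ⟨_, b.toBasis, hsymm.eigenvalues rfl, fun i j => ?_, fun i j => ?_⟩
  · rw [← hin]
    simpa using orthonormal_iff_ite.1 b.orthonormal i j
  · rw [← hT]
    have := hsymm.apply_eigenvectorBasis rfl i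
    simp only [OrthonormalBasis.coe_toBasis, b]
    rw [this, inner_smul_left]
    have h2 := orthonormal_iff_ite.1 (hsymm.eigenvectorBasis rfl).orthonormal i j
    rw [h2]
    simp

end

/-! ### Linear algebra of K, M and E₃ -/

namespace NBody

variable {n : ℕ}

@[simp] theorem rotK_rotK (q : Config n) : rotK n (rotK n q) = -q := by
  ext ⟨i, a⟩
  fin_cases a <;> simp [rotK]

theorem inner_rotK_left (q r : Config n) : inner ℝ (rotK n q) r = -inner ℝ q (rotK n r) := by
  simp only [PiLp.inner_apply, rotK, ← Finset.sum_neg_distrib, Fintype.sum_prod_type]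
  refine Finset.sum_congr rfl fun i _ => ?_
  simp [Fin.sum_univ_two]

theorem rotK_blockDiag (c : Fin n → ℝ) (q : Config n) :
    rotK n (blockDiag c q) = blockDiag c (rotK n q) := by
  ext ⟨i, a⟩
  fin_cases a <;> simp [rotK, blockDiag]

theorem inner_blockDiag_left (c : Fin n → ℝ) (q r : Config n) :
    inner ℝ (blockDiag c q) r = inner ℝ q (blockDiag c r) := by
  simp only [PiLp.inner_apply, blockDiag]
  refine Finset.sum_congr rfl fun i _ => ?_
  simp [mul_left_comm, mul_assoc]

theorem inner_massM_left (m : Fin n → ℝ) (q r : Config n) :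
    inner ℝ (massM m q) r = inner ℝ q (massM m r) := inner_blockDiag_left m q r

theorem rotK_massM (m : Fin n → ℝ) (q : Config n) :
    rotK n (massM m q) = massM m (rotK n q) := rotK_blockDiag m q

theorem massM_massInv {m : Fin n → ℝ} (hm : ∀ i, 0 < m i) (q : Config n) :
    massM m (massInv m q) = q := by
  ext ⟨i, a⟩
  simp [massM, massInv, blockDiag, (hm i).ne']

theorem massInv_massM {m : Fin n → ℝ} (hm : ∀ i, 0 < m i) (q : Config n) :
    massInv m (massM m q) = q := by
  ext ⟨i, a⟩
  simp [massM, massInv, blockDiag, (hm i).ne']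

theorem inner_massM_self_pos {m : Fin n → ℝ} (hm : ∀ i, 0 < m i) {q : Config n} (hq : q ≠ 0) :
    0 < inner ℝ (massM m q) q := by
  obtain ⟨p, hp⟩ : ∃ p, q p ≠ 0 := by
    by_contra! h
    exact hq (PiLp.ext h)
  simp only [PiLp.inner_apply, massM, blockDiag]
  refine Finset.sum_pos' (fun p _ => ?_) ⟨p, Finset.mem_univ _, ?_⟩
  · have := mul_nonneg (hm p.1).le (mul_self_nonneg (q p))
    simpa [mul_comm, mul_assoc, mul_left_comm] using this
  · have := mul_pos (hm p.1) (mul_self_pos.2 hp)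
    simpa [mul_comm, mul_assoc, mul_left_comm] using this

/-- The infinitesimal symmetries of the configuration `x`: the span of the translations, of `x`
and of `K x`. -/
def axes (x : Config n) : Submodule ℝ (Config n) :=
  Submodule.span ℝ {translationVec n, rotK n (translationVec n), x, rotK n x}

theorem rotK_mem_axes {x u : Config n} (hu : u ∈ axes x) : rotK n u ∈ axes x := by
  have hle : axes x ≤ (axes x).comap (rotK n) := by
    refine Submodule.span_le.2 ?_
    rintro w (rfl | rfl | rfl | rfl)
    · exact Submodule.subset_span (by simp)
    · rw [SetLike.mem_coe, Submodule.mem_comap, rotK_rotK, neg_mem_iff]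
      exact Submodule.subset_span (by simp)
    · exact Submodule.subset_span (by simp)
    · rw [SetLike.mem_coe, Submodule.mem_comap, rotK_rotK, neg_mem_iff]
      exact Submodule.subset_span (by simp)
  exact hle hu

/-- Since the axes are stable under K, and K commutes with M, the eight generators of E₁ and E₂
impose just two conditions: the position is M-orthogonal to the axes, the momentum
Euclidean-orthogonal to them. So E₃ = W × MW. -/
theorem mem_spaceE3_iff {m : Fin n → ℝ} {x : Config n} {z : Phase n} :
    z ∈ spaceE3 m x ↔
      ∀ u ∈ axes x, inner ℝ (massM m u) z.1 = 0 ∧ inner ℝ u z.2 = 0 := by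
  have hΩ : ∀ w : Phase n, symplecticForm n w z = -inner ℝ w.2 z.1 + inner ℝ w.1 z.2 := by
    intro w; simp [symplecticForm]
  simp only [spaceE3, LinearMap.BilinForm.mem_orthogonal_iff, hΩ]
  constructor
  · intro h
    let S : Submodule ℝ (Config n) :=
      { carrier := {u | inner ℝ (massM m u) z.1 = 0 ∧ inner ℝ u z.2 = 0}
        add_mem' := by
          rintro a b ⟨ha, ha'⟩ ⟨hb, hb'⟩
          exact ⟨by rw [map_add, inner_add_left, ha, hb, add_zero],
            by rw [inner_add_left, ha', hb', add_zero]⟩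
        zero_mem' := by simp
        smul_mem' := by
          rintro c a ⟨ha, ha'⟩
          exact ⟨by rw [map_smul, inner_smul_left, ha, mul_zero],
            by rw [inner_smul_left, ha', mul_zero]⟩ }
    have hfour : ∀ u, fourSpan m u ≤ spaceE1 m ⊔ spaceE2 m x → u ∈ S ∧ rotK n u ∈ S := by
      intro u hu
      have h1 := h _ (hu (Submodule.subset_span (Or.inl rfl)))
      have h2 := h _ (hu (Submodule.subset_span (Or.inr (Or.inl rfl))))
      have h3 := h _ (hu (Submodule.subset_span (Or.inr (Or.inr (Or.inl rfl)))))
      have h4 := h _ (hu (Submodule.subset_span (Or.inr (Or.inr (Or.inr rfl)))))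
      simp only [inner_zero_left, neg_zero, zero_add, add_zero, neg_eq_zero, rotK_massM]
        at h1 h2 h3 h4
      exact ⟨⟨h3, h1⟩, h4, h2⟩
    have hS : axes x ≤ S := by
      refine Submodule.span_le.2 ?_
      have h1 := hfour (translationVec n) le_sup_left
      have h2 := hfour x le_sup_right
      rintro w (rfl | rfl | rfl | rfl)
      exacts [h1.1, h1.2, h2.1, h2.2]
    exact fun u hu => hS hu
  · intro h
    have hfour : ∀ u ∈ axes x, fourSpan m u ≤ LinearMap.ker ((symplecticForm n).flip z) := by
      intro u hu
      refine Submodule.span_le.2 ?_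
      rintro w (rfl | rfl | rfl | rfl)
      · simpa [hΩ] using (h u hu).2
      · simpa [hΩ] using (h _ (rotK_mem_axes hu)).2
      · simpa [hΩ] using (h u hu).1
      · simpa [hΩ, rotK_massM] using (h _ (rotK_mem_axes hu)).1
    intro w hw
    have hle : spaceE1 m ⊔ spaceE2 m x ≤ LinearMap.ker ((symplecticForm n).flip z) :=
      sup_le (hfour _ (Submodule.subset_span (by simp))) (hfour _ (Submodule.subset_span (by simp)))
    have : symplecticForm n w z = 0 := hle hw
    rwa [hΩ] at this

theorem mem_configE3_iff {m : Fin n → ℝ} {x a : Config n} :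
    a ∈ configE3 m x ↔ ∀ u ∈ axes x, inner ℝ (massM m u) a = 0 := by
  rw [configE3, Submodule.mem_comap, mem_spaceE3_iff]
  simp

theorem rotK_mem_configE3 {m : Fin n → ℝ} {x a : Config n} (ha : a ∈ configE3 m x) :
    rotK n a ∈ configE3 m x := by
  rw [mem_configE3_iff] at ha ⊢
  intro u hu
  have := ha _ (rotK_mem_axes hu)
  rw [← rotK_massM, inner_rotK_left] at this
  linarith

theorem mk_massM_mem_spaceE3 {m : Fin n → ℝ} {x a w : Config n} (ha : a ∈ configE3 m x)
    (hw : w ∈ configE3 m x) : (a, massM m w) ∈ spaceE3 m x := by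
  rw [mem_configE3_iff] at ha hw
  rw [mem_spaceE3_iff]
  exact fun u hu => ⟨ha u hu, by rw [← inner_massM_left]; exact hw u hu⟩

theorem massInv_mem_configE3 {m : Fin n → ℝ} (hm : ∀ i, 0 < m i) {x y : Config n}
    (hy : ∀ u ∈ axes x, inner ℝ u y = 0) : massInv m y ∈ configE3 m x := by
  rw [mem_configE3_iff]
  intro u hu
  rw [inner_massM_left, massM_massInv hm]
  exact hy u hu

/-- A vector that pairs to zero with the axes and with the configuration part of `E₃` vanishes. -/
theorem eq_zero_of_inner_axes_of_inner_configE3 {m : Fin n → ℝ} (hm : ∀ i, 0 < m i)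
    {x y : Config n} (hy : ∀ u ∈ axes x, inner ℝ u y = 0)
    (hy' : ∀ a ∈ configE3 m x, inner ℝ a y = 0) : y = 0 := by
  -- Orthogonality to the axes puts w = M⁻¹y in the configuration part; testing y against w gives
  -- ⟨Mw, w⟩ = 0.
  have h := hy' _ (massInv_mem_configE3 hm hy)
  by_contra hne
  have hw : massInv m y ≠ 0 := by
    intro h0
    apply hne
    rw [← massM_massInv hm y, h0, map_zero]
  have := inner_massM_self_pos hm hw
  rw [massM_massInv hm, real_inner_comm] at this
  linarith

/-- `E₃` is invariant under `(a, y) ↦ (ωKa + M⁻¹y, Ba + ωKy)` if `B` maps the configuration part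
of `E₃` to the annihilator of the axes. -/
theorem spaceE3_invariant {m : Fin n → ℝ} (hm : ∀ i, 0 < m i) {x : Config n} {ω : ℝ}
    {B : Config n →ₗ[ℝ] Config n}
    (hB : ∀ a ∈ configE3 m x, ∀ u ∈ axes x, inner ℝ u (B a) = 0) {z : Phase n}
    (hz : z ∈ spaceE3 m x) :
    (ω • rotK n z.1 + massInv m z.2, B z.1 + ω • rotK n z.2) ∈ spaceE3 m x := by
  have hz1 : z.1 ∈ configE3 m x := mem_configE3_iff.2 fun u hu => (mem_spaceE3_iff.1 hz u hu).1
  rw [mem_spaceE3_iff] at hz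
  have hz2 : massInv m z.2 ∈ configE3 m x := massInv_mem_configE3 hm fun u hu => (hz u hu).2
  rw [mem_spaceE3_iff]
  intro u hu
  refine ⟨mem_configE3_iff.1 (add_mem (Submodule.smul_mem _ _ (rotK_mem_configE3 hz1)) hz2) u hu, ?_⟩
  have h2 := (hz _ (rotK_mem_axes hu)).2
  rw [inner_rotK_left] at h2
  rw [inner_add_right, hB _ hz1 u hu, inner_smul_right]
  simp [neg_eq_zero.1 h2]

end NBody

/-! ### Reduction of linear stability to the pencil -/

/-- A bilinear form with a diagonal matrix in some basis gives a weighted sum of squares. -/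
theorem equivalent_weightedSumSquares_of_basis {V ι : Type*} [AddCommGroup V] [Module ℝ V]
    [Fintype ι] [DecidableEq ι] (h : LinearMap.BilinMap ℝ V ℝ) (b : Module.Basis ι ℝ V) (d : ι → ℝ)
    (hb : ∀ i j, h (b i) (b j) = if i = j then d i else 0) :
    (LinearMap.BilinMap.toQuadraticMap h).Equivalent (QuadraticMap.weightedSumSquares ℝ d) := by
  have : (LinearMap.BilinMap.toQuadraticMap h).basisRepr b = QuadraticMap.weightedSumSquares ℝ d := by
    ext c
    rw [QuadraticMap.basisRepr_apply, LinearMap.BilinMap.toQuadraticMap_apply,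
      QuadraticMap.weightedSumSquares_apply]
    simp only [map_sum, map_smul, LinearMap.sum_apply, LinearMap.smul_apply, hb, smul_eq_mul]
    refine Finset.sum_congr rfl fun i _ => ?_
    simp
    ring
  rw [← this]
  exact ⟨QuadraticMap.isometryEquivBasisRepr _ b⟩

namespace NBody

open Matrix

variable {n : ℕ}

open scoped Classical in
theorem card_neg_add_card_zero_add_card_pos {ι : Type*} [Fintype ι] (d : ι → ℝ) :
    Fintype.card {i // d i < 0} + Fintype.card {i // d i = 0} + Fintype.card {i // 0 < d i}
      = Fintype.card ι := by
  simp only [Fintype.card_subtype, Finset.card_filter, ← Finset.sum_add_distrib]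
  rw [Fintype.card, Finset.card_eq_sum_ones]
  refine Finset.sum_congr rfl fun i _ => ?_
  rcases lt_trichotomy (d i) 0 with h | h | h
  · simp [h, h.ne, h.le.not_gt]
  · simp [h]
  · simp [h, h.ne', h.le.not_gt]

open scoped Classical in
/-- If the Morse index or the nullity is odd, then the relative equilibrium is linearly unstable,
provided that the Hessian is symmetric and maps the configuration part of `E₃` to the annihilator
of the axes. -/
theorem isLinearlyUnstable_of_odd {m : Fin n → ℝ} (hm : ∀ i, 0 < m i) {U : Config n → ℝ}
    {x : Config n} {ω : ℝ} (hω : 0 < ω)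
    (hsymm : ∀ v w, inner ℝ (hessian U x v) w = inner ℝ v (hessian U x w))
    (hB : ∀ a ∈ configE3 m x, ∀ u ∈ axes x, inner ℝ u (hessian U x a) = 0)
    (hlin : ∀ z : Phase n, linearization m U ω (relEq m ω x) z =
      (ω • rotK n z.1 + massInv m z.2, hessian U x z.1 + ω • rotK n z.2))
    (hodd : Odd (morseIndex m U ω x) ∨ Odd (nullity m U ω x)) :
    IsLinearlyUnstable m U ω (relEq m ω x) := by
  have hinv : ∀ z ∈ spaceE3 m x, linearization m U ω (relEq m ω x) z ∈ spaceE3 m x := by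
    intro z hz
    rw [hlin]
    exact spaceE3_invariant hm hB hz
  refine ⟨hinv, fun hst => ?_⟩
  have hss : ∀ z ∈ spaceE3 m x, ∀ z' ∈ spaceE3 m x, linearization m U ω (relEq m ω x) z = z' →
      linearization m U ω (relEq m ω x) z' = 0 → z' = 0 := by
    intro z hz z' hz' h h'
    have := hst.apply_eq_zero_of_apply_apply_eq_zero (z := ⟨z, hz⟩)
      (Subtype.ext (by
        change linearization m U ω (relEq m ω x) (linearization m U ω (relEq m ω x) z) = 0
        rw [h, h']))
    exact h.symm.trans (congrArg Subtype.val this)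
  have hev : ∀ μ : ℝ, μ ≠ 0 → ∀ z ∈ spaceE3 m x,
      linearization m U ω (relEq m ω x) z = μ • z → z = 0 := by
    intro μ hμ z hz h
    have := hst.eq_zero_of_eigenvector hμ (z := ⟨z, hz⟩)
      (Subtype.ext h)
    exact congrArg Subtype.val this
  set H := hessian U x + ω ^ 2 • massM m with hH
  have hHsymm : ∀ v w, inner ℝ (H v) w = inner ℝ v (H w) := by
    intro v w
    simp [hH, inner_add_left, inner_add_right, hsymm, inner_smul_left, inner_smul_right,
      inner_massM_left]
  obtain ⟨k, b, d, hbg, hbh⟩ := exists_basis_simultaneous_diagonal (V := configE3 m x)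
    (((innerₗ (Config n)).comp (massM m)).domRestrict₁₂ (configE3 m x) (configE3 m x))
    (((innerₗ (Config n)).comp H).domRestrict₁₂ (configE3 m x) (configE3 m x))
    (fun v w => by
      simp only [LinearMap.domRestrict₁₂_apply, LinearMap.comp_apply, innerₗ_apply_apply]
      rw [inner_massM_left, real_inner_comm])
    (fun v hv => inner_massM_self_pos hm (q := v) (by simpa using hv))
    (fun v w => by
      simp only [LinearMap.domRestrict₁₂_apply, LinearMap.comp_apply, innerₗ_apply_apply]
      rw [hHsymm, real_inner_comm])
  have heq : (shapeHessian m U ω x).Equivalent (QuadraticMap.weightedSumSquares ℝ d) :=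
    equivalent_weightedSumSquares_of_basis _ b d hbh
  simp only [LinearMap.domRestrict₁₂_apply, LinearMap.comp_apply, innerₗ_apply_apply] at hbg hbh
  have hind : morseIndex m U ω x = {i | d i < 0}.ncard :=
    QuadraticForm.sigNeg_of_equiv_weightedSumSquares heq
  have hnul : nullity m U ω x = {i | d i = 0}.ncard :=
    QuadraticForm.finrank_radical_of_equiv_weightedSumSquares heq
  let a : (Fin k → ℝ) → Config n := fun c => ∑ j, c j • (b j : Config n)
  have haW : ∀ c, a c ∈ configE3 m x := fun c =>
    Submodule.sum_mem _ fun j _ => Submodule.smul_mem _ _ (b j).2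
  have hag : ∀ c i, inner ℝ (massM m (b i)) (a c) = c i := by
    intro c i
    simp [a, inner_sum, inner_smul_right, hbg]
  have hah : ∀ c i, inner ℝ (b i : Config n) (H (a c)) = d i * c i := by
    intro c i
    rw [← hHsymm]
    simp [a, inner_sum, inner_smul_right, hbh, mul_comm]
  have ha0 : ∀ c, a c = 0 → c = 0 := by
    intro c h
    funext i
    rw [← hag c i, h, inner_zero_right, Pi.zero_apply]
  set K : Matrix (Fin k) (Fin k) ℝ :=
    of fun i j => inner ℝ (massM m (b i)) (rotK n (b j)) with hKdef
  have hK : ∀ c i, inner ℝ (massM m (b i)) (rotK n (a c)) = (K *ᵥ c) i := by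
    intro c i
    simp [a, hKdef, mulVec, dotProduct, inner_sum, inner_smul_right, mul_comm]
  have hKskew : Kᵀ = -K := by
    ext i j
    simp only [hKdef, transpose_apply, Matrix.neg_apply, of_apply]
    rw [inner_massM_left, ← rotK_massM, real_inner_comm, inner_rotK_left]
  have hbasis : ∀ y, (∀ i, inner ℝ (b i : Config n) y = 0) →
      ∀ v ∈ configE3 m x, inner ℝ v y = 0 := by
    intro y hy v hv
    have h := congrArg Subtype.val (b.sum_repr ⟨v, hv⟩)
    simp only [Submodule.coe_sum, Submodule.coe_smul] at h
    rw [← h, sum_inner]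
    exact Finset.sum_eq_zero fun i _ => by rw [inner_smul_left, hy, mul_zero]
  have hzero : ∀ y, (∀ u ∈ axes x, inner ℝ u y = 0) → (∀ i, inner ℝ (b i : Config n) y = 0) →
      y = 0 := fun y hy hy' =>
    eq_zero_of_inner_axes_of_inner_configE3 hm hy (hbasis y hy')
  have hMax : ∀ v ∈ configE3 m x, ∀ u ∈ axes x, inner ℝ u (massM m v) = 0 := by
    intro v hv u hu
    rw [← inner_massM_left]
    exact mem_configE3_iff.1 hv u hu
  have hHax : ∀ v ∈ configE3 m x, ∀ u ∈ axes x, inner ℝ u (H v) = 0 := by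
    intro v hv u hu
    simp [hH, inner_add_right, inner_smul_right, hB v hv u hu, hMax v hv u hu]
  have hHapply : ∀ v, hessian U x v = H v - ω ^ 2 • massM m v := by
    intro v; simp [hH]
  -- K preserves the configuration part and squares to -1 there.
  have hKdet : K.det ≠ 0 := by
    intro h
    obtain ⟨c, hc, hc0⟩ := exists_mulVec_eq_zero_iff.2 h
    refine hc (ha0 c ?_)
    have h1 : massM m (rotK n (a c)) = 0 :=
      hzero _ (hMax _ (rotK_mem_configE3 (haW c))) fun i => by
        rw [← inner_massM_left, hK, hc0, Pi.zero_apply]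
    have h2 : rotK n (a c) = 0 := by rw [← massInv_massM hm (rotK n (a c)), h1, map_zero]
    have h3 := rotK_rotK (a c)
    rwa [h2, map_zero, eq_comm, neg_eq_zero] at h3
  have hcard := even_card_of_skew hKskew hKdet
  have hpencil : Even (Fintype.card {i // d i = 0}) ∧ Even (Fintype.card {i // 0 < d i}) := by
    refine even_card_of_pencil hKskew d hω ?_ ?_
    · intro c hc hc'
      have hH0 : H (a c) = 0 := hzero _ (hHax _ (haW c)) fun i => by
        rw [hah]
        by_cases h : d i = 0
        · rw [h, zero_mul]
        · rw [hc i h, mul_zero]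
      -- This solves D c₁ = -2ωKc, which is possible because Kc vanishes where d does; the value of
      -- c₁ at those indices is immaterial.
      set c₁ : Fin k → ℝ := fun i => -(2 * ω * (K *ᵥ c) i) / d i
      have hH1 : H (a c₁) = -(2 * ω) • massM m (rotK n (a c)) := by
        rw [← sub_eq_zero]
        refine hzero _ (fun u hu => ?_) fun i => ?_
        · rw [inner_sub_right, inner_smul_right, hHax _ (haW c₁) u hu,
            hMax _ (rotK_mem_configE3 (haW c)) u hu, mul_zero, sub_zero]
        · rw [inner_sub_right, inner_smul_right, hah, ← inner_massM_left, hK]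
          by_cases h : d i = 0
          · rw [h, hc' i h]; ring
          · simp only [c₁]; field_simp; ring
      -- A Jordan chain at 0: L sends this vector to (a, -ωMKa), since H(a c₁) = -2ωMKa, and sends
      -- that one to 0, since Ha = 0. Semisimplicity forces a = 0.
      have h0 := hss (a c₁, massM m (a c - ω • rotK n (a c₁)))
        (mk_massM_mem_spaceE3 (haW _)
          (sub_mem (haW _) (Submodule.smul_mem _ _ (rotK_mem_configE3 (haW _)))))
        (a c, massM m (-ω • rotK n (a c)))
        (mk_massM_mem_spaceE3 (haW _) (Submodule.smul_mem _ _ (rotK_mem_configE3 (haW _))))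
        (by
          rw [hlin]
          simp only [massInv_massM hm, rotK_massM, hHapply, hH1, map_sub, map_smul, rotK_rotK,
            map_neg]
          refine Prod.ext ?_ ?_ <;> simp only <;> module)
        (by
          rw [hlin]
          simp only [massInv_massM hm, rotK_massM, hHapply, hH0, map_smul, rotK_rotK, map_neg]
          refine Prod.ext ?_ ?_ <;> simp only [Prod.fst_zero, Prod.snd_zero] <;> module)
      exact ha0 c (congrArg Prod.fst h0)
    · intro μ hμ c hc
      have hHa : H (a c) = μ ^ 2 • massM m (a c) - (2 * μ * ω) • massM m (rotK n (a c)) := by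
        rw [← sub_eq_zero]
        refine hzero _ (fun u hu => ?_) fun i => ?_
        · rw [inner_sub_right, inner_sub_right, inner_smul_right, inner_smul_right,
            hHax _ (haW c) u hu, hMax _ (haW c) u hu, hMax _ (rotK_mem_configE3 (haW c)) u hu]
          ring
        · rw [inner_sub_right, inner_sub_right, inner_smul_right, inner_smul_right, hah,
            ← inner_massM_left, ← inner_massM_left, hag, hK]
          linarith [hc i]
      -- The first row of L(a, y) = μ(a, y) forces y = M(μa - ωKa); the second is then the pencil
      -- equation.
      have h0 := hev μ hμ (a c, massM m (μ • a c - ω • rotK n (a c)))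
        (mk_massM_mem_spaceE3 (haW _) (sub_mem (Submodule.smul_mem _ _ (haW _))
          (Submodule.smul_mem _ _ (rotK_mem_configE3 (haW _)))))
        (by
          rw [hlin]
          simp only [massInv_massM hm, rotK_massM, hHapply, hHa, map_sub, map_smul, rotK_rotK,
            map_neg]
          refine Prod.ext ?_ ?_ <;> simp only [Prod.smul_fst, Prod.smul_snd] <;> module)
      exact ha0 c (congrArg Prod.fst h0)
  obtain ⟨hN, hpos⟩ := hpencil
  have hind' : morseIndex m U ω x = Fintype.card {i // d i < 0} := by
    rw [hind, ← Nat.card_coe_set_eq, Nat.card_eq_fintype_card]; rfl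
  have hnul' : nullity m U ω x = Fintype.card {i // d i = 0} := by
    rw [hnul, ← Nat.card_coe_set_eq, Nat.card_eq_fintype_card]; rfl
  have hsum := card_neg_add_card_zero_add_card_pos d
  rw [← hsum, ← hind', ← hnul'] at hcard
  rw [← hnul'] at hN
  clear * - hcard hN hpos hodd
  -- The Morse index is the even dimension minus the even nullity and the even number of positive
  -- entries.
  grind

end NBody

/-! ### Differential identities of an invariant potential -/

namespace NBody

open Filter Topology

variable {n : ℕ}

theorem inertia_eq_inner (m : Fin n → ℝ) (q : Config n) :
    inertia m q = inner ℝ (massM m q) q := by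
  simp only [inertia, PiLp.inner_apply, massM, blockDiag, Fintype.sum_prod_type]
  refine Finset.sum_congr rfl fun i _ => ?_
  rw [EuclideanSpace.real_norm_sq_eq]
  simp [particle, Fin.sum_univ_two]
  ring

theorem inertia_smul_rotK (m : Fin n → ℝ) (ω : ℝ) (q : Config n) :
    inertia m (ω • rotK n q) = ω ^ 2 * inner ℝ (massM m q) q := by
  rw [inertia_eq_inner, map_smul, inner_smul_left, inner_smul_right, ← rotK_massM,
    inner_rotK_left, rotK_rotK, inner_neg_right]
  simp
  ring

theorem contDiff_particle (i : Fin n) {k : WithTop ℕ∞} :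
    ContDiff ℝ k fun q : Config n => particle q i := by
  refine contDiff_euclidean.2 fun a => ?_
  fin_cases a
  · exact contDiff_piLp_apply 2 (i := (i, (0 : Fin 2)))
  · exact contDiff_piLp_apply 2 (i := (i, (1 : Fin 2)))

theorem isOpen_collisionFree : IsOpen (collisionFree n) := by
  simp only [collisionFree, Set.ofPred_forall]
  refine isOpen_iInter_of_finite fun i => isOpen_iInter_of_finite fun j =>
    isOpen_iInter_of_finite fun _ => ?_
  exact isOpen_ne_fun (contDiff_particle (k := 0) i).continuous
    (contDiff_particle (k := 0) j).continuous

theorem particle_smul (c : ℝ) (q : Config n) (i : Fin n) :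
    particle (c • q) i = c • particle q i := by
  ext a; fin_cases a <;> simp [particle]

theorem particle_add (q r : Config n) (i : Fin n) :
    particle (q + r) i = particle q i + particle r i := by
  ext a; fin_cases a <;> simp [particle]

theorem smul_mem_collisionFree {q : Config n} (hq : q ∈ collisionFree n) {c : ℝ} (hc : c ≠ 0) :
    c • q ∈ collisionFree n := by
  intro i j hij h
  rw [particle_smul, particle_smul] at h
  exact hq i j hij (smul_right_injective _ hc h)

/-- Differentiating the identity `DU(q)(Aq + e) = F(q)`. -/
theorem fderiv_fderiv_apply_of_eventually {E : Type*} [NormedAddCommGroup E] [NormedSpace ℝ E]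
    {U F : E → ℝ} {x : E} (hU : ContDiffAt ℝ 2 U x) (A : E →L[ℝ] E) (e : E) {F' : E →L[ℝ] ℝ}
    (hF : HasFDerivAt F F' x) (h : ∀ᶠ q in 𝓝 x, fderiv ℝ U q (A q + e) = F q) (w : E) :
    fderiv ℝ (fderiv ℝ U) x w (A x + e) + fderiv ℝ U x (A w) = F' w := by
  have h1 : HasFDerivAt (fderiv ℝ U) (fderiv ℝ (fderiv ℝ U) x) x :=
    ((hU.fderiv_right (m := 1) (by norm_num)).differentiableAt (by norm_num)).hasFDerivAt
  have h2 := h1.clm_apply ((A.hasFDerivAt (x := x)).add_const e)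
  have h3 := (hF.congr_of_eventuallyEq h).unique h2
  rw [h3]
  simp [add_comm]

/-- A potential on the configuration space that is twice differentiable off the collisions,
invariant under translations and rotations, and homogeneous up to a logarithmic term. -/
structure IsInvariantPotential (U : Config n → ℝ) (β c : ℝ) : Prop where
  contDiffAt : ∀ q ∈ collisionFree n, ContDiffAt ℝ 2 U q
  translation : ∀ (q : Config n) (s : ℝ), U (q + s • translationVec n) = U q
  translation' : ∀ (q : Config n) (s : ℝ), U (q + s • rotK n (translationVec n)) = U q
  rotation : ∀ (q : Config n) (θ : ℝ), U (Real.cos θ • q + Real.sin θ • rotK n q) = U q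
  scaling : ∀ q ∈ collisionFree n, ∀ ρ : ℝ, 0 < ρ → U (ρ • q) = ρ ^ (-β) * U q + c * Real.log ρ

namespace IsInvariantPotential

variable {U : Config n → ℝ} {β c : ℝ}

theorem hasFDerivAt (hU : IsInvariantPotential U β c) {q : Config n} (hq : q ∈ collisionFree n) :
    HasFDerivAt U (fderiv ℝ U q) q :=
  ((hU.contDiffAt q hq).differentiableAt (by norm_num)).hasFDerivAt

theorem fderiv_of_line_invariant (hU : IsInvariantPotential U β c) {q u : Config n}
    (hq : q ∈ collisionFree n) (h : ∀ s : ℝ, U (q + s • u) = U q) : fderiv ℝ U q u = 0 := by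
  have h1 : HasDerivAt (fun s : ℝ => q + s • u) u 0 := by
    simpa using ((hasDerivAt_id (0 : ℝ)).smul_const u).const_add q
  have h2 := HasFDerivAt.comp_hasDerivAt (0 : ℝ) (l := U) (l' := fderiv ℝ U q)
    (by simpa using hU.hasFDerivAt hq) h1
  have h3 : U ∘ (fun s : ℝ => q + s • u) = fun _ => U q := funext h
  rw [h3] at h2
  exact h2.unique (hasDerivAt_const _ _)

theorem fderiv_rotK (hU : IsInvariantPotential U β c) {q : Config n} (hq : q ∈ collisionFree n) :
    fderiv ℝ U q (rotK n q) = 0 := by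
  have h1 : HasDerivAt (fun θ : ℝ => Real.cos θ • q + Real.sin θ • rotK n q) (rotK n q) 0 := by
    simpa using ((Real.hasDerivAt_cos 0).smul_const q).fun_add
      ((Real.hasDerivAt_sin 0).smul_const (rotK n q))
  have h2 := HasFDerivAt.comp_hasDerivAt (0 : ℝ) (l := U) (l' := fderiv ℝ U q)
    (by simpa using hU.hasFDerivAt hq) h1
  have h3 : U ∘ (fun θ : ℝ => Real.cos θ • q + Real.sin θ • rotK n q) = fun _ => U q :=
    funext (hU.rotation q)
  rw [h3] at h2
  exact h2.unique (hasDerivAt_const _ _)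

/-- Euler's identity. -/
theorem fderiv_self (hU : IsInvariantPotential U β c) {q : Config n} (hq : q ∈ collisionFree n) :
    fderiv ℝ U q q = -β * U q + c := by
  have h1 : HasDerivAt (fun s : ℝ => s • q) q 1 := by
    simpa using (hasDerivAt_id (1 : ℝ)).smul_const q
  have h2 := HasFDerivAt.comp_hasDerivAt (1 : ℝ) (l := U) (l' := fderiv ℝ U q)
    (by simpa using hU.hasFDerivAt hq) h1
  have h3 : U ∘ (fun s : ℝ => s • q) =ᶠ[𝓝 1] fun s => s ^ (-β) * U q + c * Real.log s := by
    filter_upwards [lt_mem_nhds one_pos] with s hs using hU.scaling q hq s hs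
  have h4 : HasDerivAt (fun s : ℝ => s ^ (-β) * U q + c * Real.log s) (-β * U q + c) 1 := by
    simpa using ((Real.hasDerivAt_rpow_const (x := 1) (p := -β) (Or.inl one_ne_zero)).mul_const
      (U q)).fun_add ((Real.hasDerivAt_log one_ne_zero).const_mul c)
  exact h2.unique (h4.congr_of_eventuallyEq h3)

/-- This carries Newton's equation, which holds at r(t)x, back to x. -/
theorem fderiv_smul (hU : IsInvariantPotential U β c) {q : Config n} (hq : q ∈ collisionFree n)
    {ρ : ℝ} (hρ : 0 < ρ) (w : Config n) :
    fderiv ℝ U (ρ • q) (ρ • w) = ρ ^ (-β) * fderiv ℝ U q w := by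
  have h1 : HasFDerivAt (fun p : Config n => ρ • p) (ρ • ContinuousLinearMap.id ℝ (Config n)) q :=
    (hasFDerivAt_id q).const_smul ρ
  have h2 := (hU.hasFDerivAt (smul_mem_collisionFree hq hρ.ne')).comp q h1
  have h3 : (U ∘ fun p : Config n => ρ • p) =ᶠ[𝓝 q]
      fun p => ρ ^ (-β) * U p + c * Real.log ρ := by
    filter_upwards [isOpen_collisionFree.mem_nhds hq] with p hp using hU.scaling p hp ρ hρ
  have h4 := (((hU.hasFDerivAt hq).const_mul (ρ ^ (-β))).add_const
    (c * Real.log ρ)).congr_of_eventuallyEq h3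
  simpa using DFunLike.congr_fun (h2.unique h4) w

/-- A central configuration satisfies `∇U(x) = -λ M x`. -/
theorem fderiv_of_isCentralConfiguration (hU : IsInvariantPotential U β c) {m : Fin n → ℝ}
    {x : Config n} (hx : inertia m x = 1) (hcc : IsCentralConfiguration m U x) (w : Config n) :
    fderiv ℝ U x w = -(β * U x - c) * inner ℝ (massM m x) w := by
  obtain ⟨⟨hcf, _⟩, a, b, hab, r, hr, hrpos, -, hN⟩ := hcc
  obtain ⟨t, ht⟩ := Set.nonempty_Ioo.2 hab
  obtain ⟨-, hN⟩ := hN t ht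
  have hρ := hrpos t ht
  have hd1 : ∀ s ∈ Set.Ioo a b, deriv (fun t => r t • x) s = deriv r s • x := fun s hs =>
    deriv_smul_const ((hr.contDiffAt (isOpen_Ioo.mem_nhds hs)).differentiableAt (by simp)) x
  have hd2 : deriv (deriv fun t => r t • x) t = deriv (deriv r) t • x := by
    have : deriv (fun t => r t • x) =ᶠ[𝓝 t] fun s => deriv r s • x := by
      filter_upwards [isOpen_Ioo.mem_nhds ht] with s hs using hd1 s hs
    rw [this.deriv_eq]
    refine deriv_smul_const ?_ x
    have h2 : ContDiffOn ℝ 1 (deriv r) (Set.Ioo a b) :=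
      hr.deriv_of_isOpen isOpen_Ioo (by norm_cast)
    exact (h2.contDiffAt (isOpen_Ioo.mem_nhds ht)).differentiableAt (by norm_num)
  rw [hd2, map_smul] at hN
  -- Newton's equation at a single time already makes ∇U(x) parallel to Mx; Euler's identity and
  -- I(x) = 1 then determine the factor.
  have hpar : ∃ κ : ℝ, ∀ w, fderiv ℝ U x w = κ * inner ℝ (massM m x) w := by
    refine ⟨r t * deriv (deriv r) t / r t ^ (-β), fun w => ?_⟩
    have h1 := hU.fderiv_smul hcf hρ w
    rw [← inner_gradient_left, ← hN, inner_smul_left, inner_smul_right] at h1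
    have := (Real.rpow_pos_of_pos hρ (-β)).ne'
    field_simp
    rw [mul_comm, ← h1]
    simp
    ring
  obtain ⟨κ, hκ⟩ := hpar
  have h1 := hU.fderiv_self hcf
  rw [hκ, ← inertia_eq_inner, hx, mul_one] at h1
  rw [hκ, h1]
  ring

theorem inner_hessian (hU : IsInvariantPotential U β c) {x : Config n} (hx : x ∈ collisionFree n)
    (v w : Config n) : inner ℝ (hessian U x v) w = fderiv ℝ (fderiv ℝ U) x v w := by
  have h1 : HasFDerivAt (fderiv ℝ U) (fderiv ℝ (fderiv ℝ U) x) x :=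
    (((hU.contDiffAt x hx).fderiv_right (m := 1) (by norm_num)).differentiableAt
      (by norm_num)).hasFDerivAt
  have h2 : HasFDerivAt (gradient U) _ x :=
    ((InnerProductSpace.toDual ℝ (Config n)).symm.toContinuousLinearEquiv.hasFDerivAt).comp x h1
  simp only [hessian]
  rw [h2.fderiv]
  exact InnerProductSpace.toDual_symm_apply

theorem differentiableAt_gradient (hU : IsInvariantPotential U β c) {x : Config n}
    (hx : x ∈ collisionFree n) : DifferentiableAt ℝ (gradient U) x := by
  have h1 : DifferentiableAt ℝ (fderiv ℝ U) x :=
    ((hU.contDiffAt x hx).fderiv_right (m := 1) (by norm_num)).differentiableAt (by norm_num)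
  exact ((InnerProductSpace.toDual ℝ
    (Config n)).symm.toContinuousLinearEquiv.differentiableAt).comp x h1

theorem inner_hessian_comm (hU : IsInvariantPotential U β c) {x : Config n}
    (hx : x ∈ collisionFree n) (v w : Config n) :
    inner ℝ (hessian U x v) w = inner ℝ v (hessian U x w) := by
  rw [real_inner_comm (hessian U x w) v, hU.inner_hessian hx, hU.inner_hessian hx]
  exact (hU.contDiffAt x hx).isSymmSndFDerivAt (by simp) v w

theorem linearization_apply (hU : IsInvariantPotential U β c) {x : Config n}
    (hx : x ∈ collisionFree n) (m : Fin n → ℝ) (ω : ℝ) (z : Phase n) :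
    linearization m U ω (relEq m ω x) z =
      (ω • rotK n z.1 + massInv m z.2, hessian U x z.1 + ω • rotK n z.2) := by
  have hK : ∀ y, HasFDerivAt (rotK n) (rotK n).toContinuousLinearMap y := fun y =>
    (rotK n).toContinuousLinearMap.hasFDerivAt
  have hM : ∀ y, HasFDerivAt (massInv m) (massInv m).toContinuousLinearMap y := fun y =>
    (massInv m).toContinuousLinearMap.hasFDerivAt
  have hG := (hU.differentiableAt_gradient hx).hasFDerivAt
  have h1 : HasFDerivAt (Prod.fst : Phase n → Config n)
      (ContinuousLinearMap.fst ℝ (Config n) (Config n)) (relEq m ω x) := hasFDerivAt_fst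
  have h2 : HasFDerivAt (Prod.snd : Phase n → Config n)
      (ContinuousLinearMap.snd ℝ (Config n) (Config n)) (relEq m ω x) := hasFDerivAt_snd
  have h : HasFDerivAt (rotatingField m U ω) _ (relEq m ω x) :=
    ((((hK _).comp (relEq m ω x) h1).const_smul ω).add ((hM _).comp (relEq m ω x) h2)).prodMk
      ((HasFDerivAt.comp (g := gradient U) (relEq m ω x) hG h1).add
        (((hK _).comp (relEq m ω x) h2).const_smul ω))
  rw [linearization, h.fderiv]
  simp [hessian]

/-- The Hessian at a central configuration maps the configuration part of `E₃` to the annihilator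
of the axes. -/
theorem inner_axes_hessian (hU : IsInvariantPotential U β c) {m : Fin n → ℝ}
    {x : Config n} (hx : inertia m x = 1) (hcc : IsCentralConfiguration m U x) {a : Config n}
    (ha : a ∈ configE3 m x) {u : Config n} (hu : u ∈ axes x) : inner ℝ u (hessian U x a) = 0 := by
  have hcf : x ∈ collisionFree n := hcc.1.1
  have hnhds := isOpen_collisionFree.mem_nhds hcf
  have hC2 := hU.contDiffAt x hcf
  have hD := hU.fderiv_of_isCentralConfiguration hx hcc
  have hxa : x ∈ axes x := Submodule.subset_span (by simp)
  rw [real_inner_comm, hU.inner_hessian hcf]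
  -- Differentiating in the direction a the identities for DU(q) applied to the translations, to q
  -- and to Kq gives D²U(x)(a, ·) on the axes up to multiples of DU(x)a and DU(x)(Ka). These vanish:
  -- DU(x) is proportional to ⟨Mx, ·⟩, and a and Ka are M-orthogonal to x.
  have hle : axes x ≤ LinearMap.ker (fderiv ℝ (fderiv ℝ U) x a).toLinearMap := by
    refine Submodule.span_le.2 ?_
    rintro w (rfl | rfl | rfl | rfl)
    · have := fderiv_fderiv_apply_of_eventually hC2 0 (translationVec n) (hasFDerivAt_const 0 x)
        (by filter_upwards [hnhds] with q hq
            simpa using hU.fderiv_of_line_invariant hq (hU.translation q)) a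
      simpa using this
    · have := fderiv_fderiv_apply_of_eventually hC2 0 (rotK n (translationVec n))
        (hasFDerivAt_const 0 x)
        (by filter_upwards [hnhds] with q hq
            simpa using hU.fderiv_of_line_invariant hq (hU.translation' q)) a
      simpa using this
    · have := fderiv_fderiv_apply_of_eventually hC2 (ContinuousLinearMap.id ℝ _) 0
        (((hU.hasFDerivAt hcf).const_mul (-β)).add_const c)
        (by filter_upwards [hnhds] with q hq
            simpa using hU.fderiv_self hq) a
      simpa [hD, mem_configE3_iff.1 ha _ hxa] using this
    · have := fderiv_fderiv_apply_of_eventually hC2 (rotK n).toContinuousLinearMap 0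
        (hasFDerivAt_const 0 x)
        (by filter_upwards [hnhds] with q hq
            simpa using hU.fderiv_rotK hq) a
      simpa [hD, mem_configE3_iff.1 (rotK_mem_configE3 ha) _ hxa] using this
  exact hle hu

/-- The centrifugal term has gradient ω²Mx at x, which cancels ∇U(x) = -(βU(x) - c)Mx. -/
theorem isRelativeEquilibrium (hU : IsInvariantPotential U β c) {m : Fin n → ℝ}
    {x : Config n} (hx : inertia m x = 1) (hcc : IsCentralConfiguration m U x) {ω : ℝ}
    (hω : ω ^ 2 = β * U x - c) : IsRelativeEquilibrium m U ω (relEq m ω x) := by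
  refine ⟨hcc.1.1, rfl, ?_⟩
  rw [hasGradientAt_iff_hasFDerivAt, map_zero]
  have hM : HasFDerivAt (massM m) (massM m).toContinuousLinearMap x :=
    (massM m).toContinuousLinearMap.hasFDerivAt
  have h1 := (hU.hasFDerivAt hcc.1.1).add
    (((hM.inner ℝ (hasFDerivAt_id x)).const_mul (ω ^ 2)).const_mul (1 / 2))
  have h2 : augmentedPotential m U ω =
      U + fun q => 1 / 2 * (ω ^ 2 * inner ℝ (massM m q) (id q)) := by
    funext q
    simp [augmentedPotential, inertia_smul_rotK]
  change HasFDerivAt (augmentedPotential m U ω) 0 x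
  rw [h2]
  refine h1.congr_fderiv ?_
  refine ContinuousLinearMap.ext fun w => ?_
  have h3 : inner ℝ (massM m w) x = inner ℝ (massM m x) w := by
    rw [inner_massM_left, real_inner_comm]
  simp [hU.fderiv_of_isCentralConfiguration hx hcc, h3, ← hω]
  ring

/-- A relative equilibrium with odd Morse index or odd nullity is linearly unstable. -/
theorem isLinearlyUnstable (hU : IsInvariantPotential U β c) {m : Fin n → ℝ}
    (hm : ∀ i, 0 < m i) {x : Config n} (hx : inertia m x = 1) (hcc : IsCentralConfiguration m U x)
    {ω : ℝ} (hω : 0 < ω) (hodd : Odd (morseIndex m U ω x) ∨ Odd (nullity m U ω x)) :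
    IsLinearlyUnstable m U ω (relEq m ω x) :=
  isLinearlyUnstable_of_odd hm hω (hU.inner_hessian_comm hcc.1.1)
    (fun _ ha _ hu => hU.inner_axes_hessian hx hcc ha hu) (hU.linearization_apply hcc.1.1 m ω) hodd

end IsInvariantPotential

end NBody

/-! ### The homogeneous and logarithmic potentials -/

namespace NBody

variable {n : ℕ}

theorem norm_particle_sub_translation (q : Config n) (s : ℝ) (i j : Fin n) :
    ‖particle (q + s • translationVec n) i - particle (q + s • translationVec n) j‖
      = ‖particle q i - particle q j‖ := by
  have h : ∀ i, particle (translationVec n) i = !₂[1, 0] := by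
    intro i; ext a; fin_cases a <;> simp [particle, translationVec]
  rw [particle_add, particle_add, particle_smul, particle_smul, h, h, add_sub_add_right_eq_sub]

theorem norm_particle_sub_rotK_translation (q : Config n) (s : ℝ) (i j : Fin n) :
    ‖particle (q + s • rotK n (translationVec n)) i
        - particle (q + s • rotK n (translationVec n)) j‖ = ‖particle q i - particle q j‖ := by
  have h : ∀ i, particle (rotK n (translationVec n)) i = !₂[0, 1] := by
    intro i; ext a; fin_cases a <;> simp [particle, translationVec, rotK]
  rw [particle_add, particle_add, particle_smul, particle_smul, h, h, add_sub_add_right_eq_sub]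

theorem norm_particle_sub_rotation (q : Config n) (θ : ℝ) (i j : Fin n) :
    ‖particle (Real.cos θ • q + Real.sin θ • rotK n q) i
        - particle (Real.cos θ • q + Real.sin θ • rotK n q) j‖
      = ‖particle q i - particle q j‖ := by
  rw [EuclideanSpace.norm_eq, EuclideanSpace.norm_eq]
  congr 1
  simp [particle, rotK, Fin.sum_univ_two]
  linear_combination ((q (i, 0) - q (j, 0)) ^ 2 + (q (i, 1) - q (j, 1)) ^ 2) *
    Real.sin_sq_add_cos_sq θ

theorem norm_particle_sub_smul (q : Config n) {ρ : ℝ} (hρ : 0 < ρ) (i j : Fin n) :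
    ‖particle (ρ • q) i - particle (ρ • q) j‖ = ρ * ‖particle q i - particle q j‖ := by
  rw [particle_smul, particle_smul, ← smul_sub, norm_smul, Real.norm_of_nonneg hρ.le]

theorem norm_particle_sub_pos {q : Config n} (hq : q ∈ collisionFree n) {i j : Fin n}
    (hij : i < j) : 0 < ‖particle q i - particle q j‖ :=
  norm_pos_iff.2 (sub_ne_zero.2 (hq i j hij.ne))

theorem contDiffAt_norm_particle_sub {q : Config n} (hq : q ∈ collisionFree n) {i j : Fin n}
    (hij : i < j) : ContDiffAt ℝ 2 (fun q : Config n => ‖particle q i - particle q j‖) q :=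
  ((contDiff_particle i).sub (contDiff_particle j)).contDiffAt.norm ℝ
    (sub_ne_zero.2 (hq i j hij.ne))

theorem isInvariantPotential_potHom (m : Fin n → ℝ) (α : ℝ) :
    IsInvariantPotential (potHom m α) α 0 where
  contDiffAt q hq := by
    unfold potHom
    refine ContDiffAt.sum fun i _ => ContDiffAt.sum fun j hj => ?_
    have hij := Finset.mem_Ioi.1 hj
    have h := norm_particle_sub_pos hq hij
    exact contDiffAt_const.div ((contDiffAt_norm_particle_sub hq hij).rpow_const_of_ne h.ne')
      (Real.rpow_pos_of_pos h α).ne'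
  translation q s := by simp only [potHom, norm_particle_sub_translation]
  translation' q s := by simp only [potHom, norm_particle_sub_rotK_translation]
  rotation q θ := by simp only [potHom, norm_particle_sub_rotation]
  scaling q _ ρ hρ := by
    simp only [potHom, norm_particle_sub_smul q hρ, zero_mul, add_zero, Finset.mul_sum]
    refine Finset.sum_congr rfl fun i _ => Finset.sum_congr rfl fun j _ => ?_
    rw [Real.mul_rpow hρ.le (norm_nonneg _), Real.rpow_neg hρ.le]
    field_simp

/-- Scaling by ρ adds log ρ to every log-distance, hence β = 0 and c is minus the sum of the mass
products; βU - c is then the multiplier λ for I = 1. -/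
theorem isInvariantPotential_potLog (m : Fin n → ℝ) :
    IsInvariantPotential (potLog m) 0 (-∑ i, ∑ j ∈ Finset.Ioi i, m i * m j) where
  contDiffAt q hq := by
    unfold potLog
    refine ContDiffAt.neg (ContDiffAt.sum fun i _ => ContDiffAt.sum fun j hj => ?_)
    have hij := Finset.mem_Ioi.1 hj
    exact contDiffAt_const.mul
      ((contDiffAt_norm_particle_sub hq hij).log (norm_particle_sub_pos hq hij).ne')
  translation q s := by simp only [potLog, norm_particle_sub_translation]
  translation' q s := by simp only [potLog, norm_particle_sub_rotK_translation]
  rotation q θ := by simp only [potLog, norm_particle_sub_rotation]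
  scaling q hq ρ hρ := by
    simp only [potLog, norm_particle_sub_smul q hρ, neg_zero, Real.rpow_zero, one_mul, neg_mul,
      Finset.sum_mul, ← Finset.sum_neg_distrib, ← Finset.sum_add_distrib]
    refine Finset.sum_congr rfl fun i _ => Finset.sum_congr rfl fun j hj => ?_
    rw [Real.log_mul hρ.ne' (norm_particle_sub_pos hq (Finset.mem_Ioi.1 hj)).ne']
    ring

theorem sum_pairs_pos (hn : 2 ≤ n) {f : Fin n → Fin n → ℝ} (hf : ∀ i j, i < j → 0 < f i j) :
    0 < ∑ i, ∑ j ∈ Finset.Ioi i, f i j := by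
  have h : ∀ i, ∀ j ∈ Finset.Ioi i, 0 < f i j := fun i j hj => hf i j (Finset.mem_Ioi.1 hj)
  refine Finset.sum_pos' (fun i _ => Finset.sum_nonneg fun j hj => (h i j hj).le)
    ⟨⟨0, by omega⟩, Finset.mem_univ _, Finset.sum_pos (h _) ⟨⟨1, by omega⟩, ?_⟩⟩
  simp

end NBody

/-! ### The theorem for both potentials -/

theorem mainTheorem6 {n : ℕ} (hn : 3 ≤ n) (m : Fin n → ℝ) (hm : ∀ i, 0 < m i)
    (x : NBody.Config n) (hx : x ∈ NBody.ellipsoid m) :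
    (∀ α ω : ℝ, 0 < α → α < 2 → ω = √(NBody.lamHom m α x) →
      NBody.IsCentralConfiguration m (NBody.potHom m α) x →
      Odd (NBody.morseIndex m (NBody.potHom m α) ω x) ∨
        Odd (NBody.nullity m (NBody.potHom m α) ω x) →
      NBody.IsRelativeEquilibrium m (NBody.potHom m α) ω (NBody.relEq m ω x) ∧
        NBody.IsLinearlyUnstable m (NBody.potHom m α) ω (NBody.relEq m ω x)) ∧
    (∀ ω : ℝ, ω = √(NBody.lamLog m x) →
      NBody.IsCentralConfiguration m (NBody.potLog m) x →
      Odd (NBody.morseIndex m (NBody.potLog m) ω x) ∨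
        Odd (NBody.nullity m (NBody.potLog m) ω x) →
      NBody.IsRelativeEquilibrium m (NBody.potLog m) ω (NBody.relEq m ω x) ∧
        NBody.IsLinearlyUnstable m (NBody.potLog m) ω (NBody.relEq m ω x)) := by
  have hI := hx.2
  have hcf := hx.1.1
  refine ⟨fun α ω hα _ hω hcc hodd => ?_, fun ω hω hcc hodd => ?_⟩
  · have hU := NBody.isInvariantPotential_potHom m α
    -- Positivity of λ gives both ω > 0, needed for N to be invertible, and ω² = λ.
    have hpos : 0 < NBody.lamHom m α x := by
      rw [NBody.lamHom, hI, div_one]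
      exact mul_pos hα (NBody.sum_pairs_pos (by omega) fun i j hij =>
        div_pos (mul_pos (hm i) (hm j))
          (Real.rpow_pos_of_pos (NBody.norm_particle_sub_pos hcf hij) α))
    refine ⟨hU.isRelativeEquilibrium hI hcc ?_,
      hU.isLinearlyUnstable hm hI hcc (hω ▸ Real.sqrt_pos.2 hpos) hodd⟩
    rw [hω, Real.sq_sqrt hpos.le, NBody.lamHom, hI, div_one, sub_zero]
  · have hU := NBody.isInvariantPotential_potLog m
    have hpos : 0 < NBody.lamLog m x := by
      rw [NBody.lamLog, hI, div_one]
      exact NBody.sum_pairs_pos (by omega) fun i j _ => mul_pos (hm i) (hm j)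
    refine ⟨hU.isRelativeEquilibrium hI hcc ?_,
      hU.isLinearlyUnstable hm hI hcc (hω ▸ Real.sqrt_pos.2 hpos) hodd⟩
    rw [hω, Real.sq_sqrt hpos.le, NBody.lamLog, hI, div_one, zero_mul, zero_sub, neg_neg]
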